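/- Conventions. An action $\alpha$ of a group $G$ by measurable transformations on a measure space $(X,\mu)$ is ergodic if every measurable set $S\subseteq X$ with $\mu(S\,\triangle\,\alpha_g(S))=0$ for all $g\in G$ satisfies $\mu(S)=0$ or $\mu(X\setminus S)=0$. For a symmetric, nonnegative, injective, trace-class operator $K$ on a real Hilbert space $\mathcal V_-$ with scalar product $(\cdot\mid\cdot)_-$, the centered Gaussian measure with variance $K$ is the Borel probability measure $\gamma$ on $\mathcal V_-$ with $$\int_{\mathcal V_-}e^{i(x\mid y)_-}\,d\gamma(y)=e^{-\frac12(Kx\mid x)_-}\qquad\text{for all }x\in\mathcal V_-.$$ Corollary. (a) Let $\mathcal V_-$ be a real Hilbert space, let $K$ be a symmetric, nonnegative, injective, trace-class operator on $\mathcal V_-$, let $\gamma$ be the centered Gaussian measure on $\mathcal V_-$ with variance $K$, and let $\mathcal V_+:=\operatorname{Ran}K$. Then the action $(x,v)\mapsto x+v$ of the additive group $\mathcal V_+$ on $(\mathcal V_-,\gamma)$ by translations is ergodic. (b) Let $\mathcal V_+$ be a real Hilbert space with scalar product $(\cdot\mid\cdot)_+$ and let $A$ be a symmetric, nonnegative,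 injective, trace-class operator on $\mathcal V_+$. Let $\mathcal V_-$ be the completion of $\mathcal V_+$ with respect to the scalar product $(x\mid y)_-:=(Ax\mid Ay)_+$, let $K$ be the bounded operator on $\mathcal V_-$ that extends $A$ (it is again symmetric, nonnegative, injective and trace-class), and let $\gamma$ be the centered Gaussian measure on $\mathcal V_-$ with variance $K$. Then the action $(x,v)\mapsto x+v$ of the additive group $\mathcal V_+\subseteq\mathcal V_-$ on $(\mathcal V_-,\gamma)$ by translations is ergodic. -/

import Mathlib

open MeasureTheory Set
open scoped InnerProductSpace symmDiff

noncomputable section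

namespace GaussianTranslation

/-- `α` is a group action of the (additively written) group `G` on the measure space `(X, μ)` by
measurable transformations, and this action is ergodic: a measurable set `S` with
`μ (S ∆ α g (S)) = 0` for all `g` is null or conull. -/
structure IsErgodicAction {G X : Type*} [AddGroup G] [MeasurableSpace X]
    (α : G → X → X) (μ : Measure X) : Prop where
  zero_act : ∀ x, α 0 x = x
  add_act : ∀ g h x, α (g + h) x = α g (α h x)
  measurable_act : ∀ g, Measurable (α g)
  null_or_conull : ∀ S : Set X, MeasurableSet S → (∀ g, μ (S ∆ (α g '' S)) = 0) →
    μ S = 0 ∨ μ Sᶜ = 0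

/-- The action of `G` on `X` by translations, `G` being mapped to `X` by an additive map. -/
def translation {G X : Type*} [AddGroup G] [AddGroup X] (ι : G →+ X) : G → X → X :=
  fun g v => ι g + v

/-- `K` is symmetric, nonnegative, injective and trace-class. For a symmetric nonnegative operator,
trace-class means that `∑ᵢ (K eᵢ ∣ eᵢ)` converges for some, equivalently for every,
orthonormal basis `(eᵢ)`. -/
structure IsInjectiveNonnegTraceClass {E : Type*} [NormedAddCommGroup E] [InnerProductSpace ℝ E]
    (K : E →L[ℝ] E) : Prop where
  /-- symmetric, and `(K x ∣ x) ≥ 0` for all `x` -/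
  isPositive : K.IsPositive
  injective : Function.Injective K
  traceClass : ∃ (s : Set E) (e : HilbertBasis s ℝ E), Summable fun i => ⟪K (e i), e i⟫_ℝ

/-- `γ` is the Gaussian measure with mean `a` and variance `K`: the Borel probability
measure with `∫ exp (i (x ∣ y)) dγ(y) = exp (i (a ∣ x) - (K x ∣ x) / 2)` for all `x`. -/
structure IsGaussianMeasure {E : Type*} [NormedAddCommGroup E] [InnerProductSpace ℝ E]
    [MeasurableSpace E] (a : E) (K : E →L[ℝ] E) (γ : Measure E) : Prop where
  isProbabilityMeasure : IsProbabilityMeasure γ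
  integral_exp : ∀ x : E, ∫ y, Complex.exp (Complex.I * (⟪x, y⟫_ℝ : ℂ)) ∂γ =
    Complex.exp (Complex.I * (⟪a, x⟫_ℝ : ℂ) - (⟪K x, x⟫_ℝ : ℂ) / 2)

section Completion

variable {V : Type*} [NormedAddCommGroup V] [InnerProductSpace ℝ V]

/-- The vector space `V`, to be equipped with the scalar product `(x ∣ y)₋ = (A x ∣ A y)`. -/
def PreMinus (_A : V →L[ℝ] V) : Type _ := V

variable (A : V →L[ℝ] V)

instance : AddCommGroup (PreMinus A) := inferInstanceAs (AddCommGroup V)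

instance : Module ℝ (PreMinus A) := inferInstanceAs (Module ℝ V)

/-- The identity map from `V` to `PreMinus A`. -/
def toPreMinus : V ≃ₗ[ℝ] PreMinus A := LinearEquiv.refl ℝ V

instance : SeminormedAddCommGroup (PreMinus A) :=
  SeminormedAddCommGroup.induced (PreMinus A) V (A.toLinearMap ∘ₗ (toPreMinus A).symm.toLinearMap)

theorem preMinus_norm (x : PreMinus A) : ‖x‖ = ‖A ((toPreMinus A).symm x)‖ := rfl

instance : InnerProductSpace ℝ (PreMinus A) where
  norm_smul_le c x := by
    simp [preMinus_norm, norm_smul]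
  inner x y := ⟪A ((toPreMinus A).symm x), A ((toPreMinus A).symm y)⟫_ℝ
  norm_sq_eq_re_inner x := by
    simp [preMinus_norm]
  conj_inner_symm x y := real_inner_comm _ _
  add_left x y z := by
    simp [inner_add_left]
  smul_left x y r := by
    simp [real_inner_smul_left]

/-- The Hilbert space `V₋`, the completion of `V₊` with respect to the scalar product
`(x ∣ y)₋ = (A x ∣ A y)₊`. -/
abbrev VMinus : Type _ := UniformSpace.Completion (PreMinus A)

/-- The canonical linear map `V₊ → V₋`. -/
def toVMinus : V →ₗ[ℝ] VMinus A :=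
  (UniformSpace.Completion.toComplL (𝕜 := ℝ) (E := PreMinus A)).toLinearMap ∘ₗ
    (toPreMinus A).toLinearMap

theorem inner_toVMinus (x y : V) : ⟪toVMinus A x, toVMinus A y⟫_ℝ = ⟪A x, A y⟫_ℝ :=
  UniformSpace.Completion.inner_coe (𝕜 := ℝ) (toPreMinus A x) (toPreMinus A y)

/-- The operator `A`, viewed as a bounded operator for the scalar product `(x ∣ y)₋`. -/
def preMinusOp : PreMinus A →L[ℝ] PreMinus A :=
  LinearMap.mkContinuous
    ((toPreMinus A).toLinearMap ∘ₗ A.toLinearMap ∘ₗ (toPreMinus A).symm.toLinearMap) ‖A‖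
    (fun x => A.le_opNorm (A ((toPreMinus A).symm x)))

/-- The bounded operator `K` on `V₋` that extends `A`. -/
def extOp : VMinus A →L[ℝ] VMinus A :=
  ((UniformSpace.Completion.toComplL (𝕜 := ℝ) (E := PreMinus A)).comp (preMinusOp A)).extend
    (UniformSpace.Completion.toComplL (𝕜 := ℝ) (E := PreMinus A))

theorem extOp_toVMinus (x : V) : extOp A (toVMinus A x) = toVMinus A (A x) :=
  ContinuousLinearMap.extend_eq _ (UniformSpace.Completion.denseRange_coe (α := PreMinus A))
    (UniformSpace.Completion.isUniformInducing_coe (PreMinus A)) (toPreMinus A x)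

end Completion

end GaussianTranslation

end

open ProbabilityTheory

namespace GaussianTranslation

section General

variable {E : Type*} [NormedAddCommGroup E] [InnerProductSpace ℝ E]

/-! By Cameron–Martin (`map_add_eq_tilted`), translating `γ` by `K x` multiplies it by the
normalized density `exp (x ∣ ·)`. If `S` is invariant, `∫_S exp (x ∣ ·) dγ = γ(S) ∫ exp (x ∣ ·) dγ`
for all `x` in a dense subspace, so `γ` restricted to `S` and `γ(S) γ` have the same Laplace
transform there and coincide (`ext_of_integral_exp_inner`). Evaluating on `Sᶜ` gives `γ(S) γ(Sᶜ) =
0`. Injectivity and trace class serve only to make the space separable. -/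

/-- A Hilbert space carrying an injective nonnegative trace-class operator is separable. -/
theorem IsInjectiveNonnegTraceClass.separableSpace {K : E →L[ℝ] E}
    (hK : IsInjectiveNonnegTraceClass K) : TopologicalSpace.SeparableSpace E := by
  obtain ⟨s, e, hs⟩ := hK.traceClass
  -- A summable family has countable support, so nonzero diagonal entries force a countable basis.
  have hpos (i : s) : ⟪K (e i), e i⟫_ℝ ≠ 0 := by
    intro h0
    have hsymm (x y : E) : ⟪K x, y⟫_ℝ = ⟪x, K y⟫_ℝ := hK.isPositive.isSymmetric x y
    have hnonneg (x : E) : 0 ≤ ⟪K x, x⟫_ℝ := hK.isPositive.inner_nonneg_left x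
    -- The Cauchy–Schwarz inequality for the form `⟪K x, y⟫`, with vanishing `⟪K e, e⟫`.
    have hKe : K (e i) = 0 := by
      by_contra hne
      have hn : 0 < ⟪K (e i), K (e i)⟫_ℝ := real_inner_self_pos.2 hne
      set a := ⟪K (e i), K (e i)⟫_ℝ with ha
      set b := ⟪K (K (e i)), K (e i)⟫_ℝ with hb
      have hb0 : 0 ≤ b := hnonneg _
      have key (t : ℝ) : 0 ≤ 2 * t * a + t ^ 2 * b := by
        have h := hnonneg (e i + t • K (e i))
        have h1 : ⟪K (K (e i)), e i⟫_ℝ = a := hsymm _ _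
        simp only [map_add, map_smul, inner_add_left, inner_add_right, real_inner_smul_left,
          real_inner_smul_right, h0, h1, ← ha, ← hb] at h
        linarith
      -- The minimizer would be `-a / b`; the shift to `b + 1` covers `b = 0`.
      have h := key (-(a / (b + 1)))
      have hb1 : 0 < b + 1 := by linarith
      have : 2 * -(a / (b + 1)) * a + (-(a / (b + 1))) ^ 2 * b
          = -(a ^ 2 * (b + 2) / (b + 1) ^ 2) := by
        field_simp
        ring
      have hlt : 0 < a ^ 2 * (b + 2) / (b + 1) ^ 2 := by positivity
      linarith
    have h1 : e i = 0 := hK.injective (by rw [hKe, map_zero])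
    have := e.orthonormal.ne_zero i
    exact this h1
  have hcount : Countable s := by
    have := hs.countable_support
    rw [Function.support_eq_univ hpos] at this
    exact countable_univ_iff.1 this
  have hsep : TopologicalSpace.IsSeparable
      (closure (Submodule.span ℝ (range e) : Set E)) :=
    (countable_range e).isSeparable.span.closure
  rw [← Submodule.topologicalClosure_coe, e.dense_span, Submodule.top_coe] at hsep
  exact TopologicalSpace.isSeparable_univ_iff.1 hsep

variable [CompleteSpace E] [SecondCountableTopology E] [MeasurableSpace E] [BorelSpace E]

/-- Two finite measures on a Hilbert space whose moment generating functions are finite and equal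
on a dense subspace are equal. -/
theorem ext_of_integral_exp_inner {μ ν : Measure E} [IsFiniteMeasure μ] [IsFiniteMeasure ν]
    {D : Submodule ℝ E} (hD : Dense (D : Set E))
    (hint : ∀ x ∈ D, Integrable (fun y => Real.exp ⟪x, y⟫_ℝ) μ)
    (h : ∀ x ∈ D, ∫ y, Real.exp ⟪x, y⟫_ℝ ∂μ = ∫ y, Real.exp ⟪x, y⟫_ℝ ∂ν) : μ = ν := by
  -- For nonzero measures, integrability of the exponential is equivalent to a nonzero mgf, so
  -- integrability for `ν` can be read off from that for `μ`.
  have h0 : μ = 0 ↔ ν = 0 := by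
    have := h 0 D.zero_mem
    simp only [inner_zero_left, Real.exp_zero, integral_const, smul_eq_mul, mul_one] at this
    rw [← Measure.measure_univ_eq_zero, ← Measure.measure_univ_eq_zero,
      ← measureReal_eq_zero_iff, ← measureReal_eq_zero_iff, this]
  refine Measure.ext_of_charFun (continuous_charFun.ext_on hD continuous_charFun fun x hx => ?_)
  have hsmul (t : ℝ) (y : E) : t * ⟪x, y⟫_ℝ = ⟪t • x, y⟫_ℝ := (real_inner_smul_left x y t).symm
  have hmgf : mgf (fun y => ⟪x, y⟫_ℝ) μ = mgf (fun y => ⟪x, y⟫_ℝ) ν := by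
    ext t
    simp only [mgf, hsmul]
    exact h _ (D.smul_mem t hx)
  have huniv : integrableExpSet (fun y => ⟪x, y⟫_ℝ) μ = univ := by
    refine eq_univ_of_forall fun t => ?_
    simp only [integrableExpSet, mem_ofPred_eq, hsmul]
    exact hint _ (D.smul_mem t hx)
  -- The mgf along `x` is finite on all of `ℝ`, so it continues analytically to `I`, where it is the
  -- characteristic function.
  have hc := eqOn_complexMGF_of_mgf' hmgf h0 (x := Complex.I) (by simp [huniv])
  simpa only [complexMGF, charFun_apply, real_inner_comm, mul_comm Complex.I] using hc

variable {K : E →L[ℝ] E} {γ : Measure E}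

omit [CompleteSpace E] in
/-- The law of `(x ∣ ·)` under the centered Gaussian measure with variance `K` is the centered
Gaussian measure with variance `(K x ∣ x)`. -/
theorem IsGaussianMeasure.map_inner (hγ : IsGaussianMeasure 0 K γ) (hK : K.IsPositive) (x : E) :
    γ.map (fun y => ⟪x, y⟫_ℝ) = gaussianReal 0 (⟪K x, x⟫_ℝ).toNNReal := by
  have := hγ.isProbabilityMeasure
  have hm : Measurable fun y : E => ⟪x, y⟫_ℝ := by fun_prop
  have hpos : 0 ≤ ⟪K x, x⟫_ℝ := hK.inner_nonneg_left x
  refine Measure.ext_of_charFun (funext fun t => ?_)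
  rw [charFun_gaussianReal, charFun_apply_real, integral_map hm.aemeasurable (by fun_prop)]
  have h := hγ.integral_exp (t • x)
  simp only [real_inner_smul_left, real_inner_smul_right, map_smul, inner_zero_left] at h
  rw [Real.coe_toNNReal _ hpos]
  convert h using 2
  · ext y
    congr 1
    push_cast
    ring
  · push_cast
    ring

omit [CompleteSpace E] in
theorem IsGaussianMeasure.integrable_exp_inner (hγ : IsGaussianMeasure 0 K γ) (hK : K.IsPositive)
    (x : E) : Integrable (fun y => Real.exp ⟪x, y⟫_ℝ) γ := by
  have h := integrable_exp_mul_gaussianReal (μ := 0) (v := (⟪K x, x⟫_ℝ).toNNReal) 1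
  rw [← hγ.map_inner hK x, integrable_map_measure (by fun_prop) (by fun_prop)] at h
  simpa [Function.comp_def] using h

omit [CompleteSpace E] in
theorem IsGaussianMeasure.integral_exp_inner (hγ : IsGaussianMeasure 0 K γ) (hK : K.IsPositive)
    (x : E) : ∫ y, Real.exp ⟪x, y⟫_ℝ ∂γ = Real.exp (⟪K x, x⟫_ℝ / 2) := by
  have h := mgf_gaussianReal (hγ.map_inner hK x) 1
  simpa [mgf, Real.coe_toNNReal _ (hK.inner_nonneg_left x)] using h

/-- The Cameron–Martin formula for translations by elements of `Ran K`. -/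
theorem IsGaussianMeasure.map_add_eq_tilted (hγ : IsGaussianMeasure 0 K γ) (hK : K.IsPositive)
    (x : E) : γ.map (fun y => K x + y) = γ.tilted (fun y => ⟪x, y⟫_ℝ) := by
  have := hγ.isProbabilityMeasure
  have : IsProbabilityMeasure (γ.map (fun y => K x + y)) :=
    Measure.isProbabilityMeasure_map (by fun_prop)
  have := isProbabilityMeasure_tilted (hγ.integrable_exp_inner hK x)
  refine ext_of_integral_exp_inner (D := ⊤) (by simp) (fun z _ => ?_) (fun z _ => ?_)
  · rw [integrable_map_measure (by fun_prop) (by fun_prop)]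
    simp only [Function.comp_def, inner_add_right, Real.exp_add]
    exact (hγ.integrable_exp_inner hK z).const_mul _
  · rw [integral_map (by fun_prop) (by fun_prop), integral_exp_tilted]
    simp only [Pi.add_apply, ← inner_add_left, hγ.integral_exp_inner hK]
    simp only [inner_add_right, Real.exp_add, integral_const_mul, hγ.integral_exp_inner hK]
    rw [← Real.exp_add, ← Real.exp_sub]
    -- By symmetry of `K`, both exponents equal `(z ∣ K x) + (K z ∣ z) / 2`.
    have h1 : ⟪K z, x⟫_ℝ = ⟪z, K x⟫_ℝ := hK.isSymmetric z x
    have h2 : ⟪K x, z⟫_ℝ = ⟪z, K x⟫_ℝ := real_inner_comm _ _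
    simp only [map_add, inner_add_left, h1, h2]
    congr 1
    ring

/-- The translations by the elements of a group containing `K x`, for all `x` in a dense subspace,
act ergodically on the Gaussian measure with variance `K`. -/
theorem IsGaussianMeasure.isErgodicAction_translation {G : Type*} [AddGroup G] {ι : G →+ E}
    (hγ : IsGaussianMeasure 0 K γ) (hK : K.IsPositive) {D : Submodule ℝ E}
    (hD : Dense (D : Set E)) (hι : ∀ x ∈ D, K x ∈ range ι) :
    IsErgodicAction (translation ι) γ where
  zero_act x := by simp [translation]
  add_act g h x := by simp [translation, add_assoc]
  measurable_act g := by
    unfold translation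
    fun_prop
  null_or_conull S hS hinv := by
    have := hγ.isProbabilityMeasure
    have hshift (x : E) (hx : x ∈ D) : γ.tilted (fun y => ⟪x, y⟫_ℝ) S = γ S := by
      obtain ⟨g, hg⟩ := hι x hx
      rw [← hγ.map_add_eq_tilted hK x, Measure.map_apply (by fun_prop) hS]
      -- Invariance concerns images and the pushforward preimages, hence `-g`.
      have himage : translation ι (-g) '' S = (fun y => K x + y) ⁻¹' S := by
        change (fun y => ι (-g) + y) '' S = _
        rw [image_add_left, map_neg, neg_neg, hg]
      rw [← himage]
      exact (measure_congr (measure_symmDiff_eq_zero_iff.1 (hinv (-g)))).symm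
    have hset (x : E) (hx : x ∈ D) :
        ∫ y in S, Real.exp ⟪x, y⟫_ℝ ∂γ = γ.real S * ∫ y, Real.exp ⟪x, y⟫_ℝ ∂γ := by
      have h := hshift x hx
      rw [tilted_apply_eq_ofReal_integral, integral_div] at h
      have hpos : 0 < ∫ y, Real.exp ⟪x, y⟫_ℝ ∂γ :=
        integral_exp_pos (hγ.integrable_exp_inner hK x)
      rw [measureReal_def, ← h, ENNReal.toReal_ofReal, div_mul_cancel₀ _ hpos.ne']
      exact div_nonneg (integral_nonneg fun y => (Real.exp_pos _).le) hpos.le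
    have heq : γ.restrict S = γ S • γ := by
      have : IsFiniteMeasure (γ S • γ) := Measure.smul_finite _ (measure_ne_top _ _)
      refine ext_of_integral_exp_inner hD
        (fun x _ => (hγ.integrable_exp_inner hK x).integrableOn) (fun x hx => ?_)
      rw [hset x hx, integral_smul_measure, smul_eq_mul, measureReal_def]
    have hcompl := congrArg (fun μ : Measure E => μ Sᶜ) heq
    simp only [Measure.restrict_apply hS.compl, compl_inter_self, measure_empty,
      Measure.smul_apply, smul_eq_mul] at hcompl
    exact mul_eq_zero.1 hcompl.symm

end General

section Completion

variable {V : Type*} [NormedAddCommGroup V] [InnerProductSpace ℝ V] {A : V →L[ℝ] V}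

theorem norm_toVMinus (x : V) : ‖toVMinus A x‖ = ‖A x‖ :=
  UniformSpace.Completion.norm_coe (toPreMinus A x)

theorem denseRange_toVMinus : DenseRange (toVMinus A) :=
  UniformSpace.Completion.denseRange_coe (α := PreMinus A)

/-- Continuity and dense range carry separability from `V₊` to `V₋`. -/
theorem continuous_toVMinus : Continuous (toVMinus A) :=
  AddMonoidHomClass.continuous_of_bound (toVMinus A) ‖A‖ fun x =>
    (norm_toVMinus x).trans_le (A.le_opNorm x)

/-- The extension of a nonnegative operator `A` to the completion is nonnegative. -/
theorem extOp_isPositive (hA : A.IsPositive) : (extOp A).IsPositive := by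
  refine ⟨fun x y => ?_, fun x => ?_⟩
  · refine denseRange_toVMinus.induction_on₂ (p := fun x y => ⟪extOp A x, y⟫_ℝ = ⟪x, extOp A y⟫_ℝ)
      (isClosed_eq (by fun_prop) (by fun_prop)) (fun v w => ?_) x y
    rw [extOp_toVMinus, extOp_toVMinus, inner_toVMinus, inner_toVMinus]
    exact hA.isSymmetric (A v) (A w)
  · change 0 ≤ ⟪extOp A x, x⟫_ℝ
    refine denseRange_toVMinus.induction_on (p := fun x => 0 ≤ ⟪extOp A x, x⟫_ℝ) x
      (isClosed_le (by fun_prop) (by fun_prop)) (fun v => ?_)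
    rw [extOp_toVMinus, inner_toVMinus]
    exact hA.inner_nonneg_left (A v)

end Completion

end GaussianTranslation

/-- The first part takes the pair `(V₋, K)` as given and puts `V₊ = Ran K`; the second part takes
`(V₊, A)` as given, and `V₋` and `K` are the completion and the extension of `A` to it. -/
theorem corollary4p4 :
    (∀ (Vm : Type*) [NormedAddCommGroup Vm] [InnerProductSpace ℝ Vm] [CompleteSpace Vm]
        [MeasurableSpace Vm] [BorelSpace Vm] (K : Vm →L[ℝ] Vm) (γ : MeasureTheory.Measure Vm),
      GaussianTranslation.IsInjectiveNonnegTraceClass K →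
      GaussianTranslation.IsGaussianMeasure 0 K γ →
      GaussianTranslation.IsErgodicAction
        (GaussianTranslation.translation K.toLinearMap.range.subtype.toAddMonoidHom) γ) ∧
    (∀ (Vp : Type*) [NormedAddCommGroup Vp] [InnerProductSpace ℝ Vp] [CompleteSpace Vp]
        (A : Vp →L[ℝ] Vp)
        [MeasurableSpace (GaussianTranslation.VMinus A)] [BorelSpace (GaussianTranslation.VMinus A)]
        (γ : MeasureTheory.Measure (GaussianTranslation.VMinus A)),
      GaussianTranslation.IsInjectiveNonnegTraceClass A →
      GaussianTranslation.IsGaussianMeasure 0 (GaussianTranslation.extOp A) γ →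
      GaussianTranslation.IsErgodicAction
        (GaussianTranslation.translation (GaussianTranslation.toVMinus A).toAddMonoidHom) γ) := by
  refine ⟨?_, ?_⟩
  · intro Vm _ _ _ _ _ K γ hK hγ
    have := hK.separableSpace
    have := UniformSpace.secondCountable_of_separable Vm
    exact hγ.isErgodicAction_translation hK.isPositive (D := ⊤) (by simp)
      fun x _ => ⟨⟨K x, x, rfl⟩, rfl⟩
  · intro Vp _ _ _ A _ _ γ hA hγ
    have := hA.separableSpace
    have : TopologicalSpace.SeparableSpace (GaussianTranslation.VMinus A) :=
      GaussianTranslation.denseRange_toVMinus.separableSpace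
        GaussianTranslation.continuous_toVMinus
    have := UniformSpace.secondCountable_of_separable (GaussianTranslation.VMinus A)
    -- Since `K` extends `A`, it maps the dense image of `V₊` into itself, so the range of `K` on
    -- all of `V₋` need not be identified.
    refine hγ.isErgodicAction_translation (GaussianTranslation.extOp_isPositive hA.isPositive)
      (D := (GaussianTranslation.toVMinus A).range)
      GaussianTranslation.denseRange_toVMinus ?_
    rintro _ ⟨x, rfl⟩
    exact ⟨A x, (GaussianTranslation.extOp_toVMinus A x).symm⟩
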